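/- Let $g(n)=\max\{\operatorname{lcm}(p_1,\ldots,p_k) : k\geqslant 1,\ p_1,\ldots,p_k\geqslant 1,\ p_1+\cdots+p_k\leqslant n\}$ be Landau's function. There is an absolute constant $C$ such that the following holds for every $n\geqslant 1$. Let $A$ be a unary nondeterministic finite automaton with $n$ states, that is, a finite set $Q$ of $n$ states, a set $Q_0\subseteq Q$ of initial states and a transition function $\delta\colon Q\times\{a\}\to 2^Q$ over a one-letter alphabet $\{a\}$ (accepting states are irrelevant). Let $\mathcal{C}$ be the deterministic finite automaton made from $A$ by the subset construction: its set of states is $2^Q$, its initial state is $Q_0$, and its transition function is $\delta'(S,a)=\bigcup_{q\in S}\delta(q,a)$. Then $\mathcal{C}$ has at most $g(n)+C\,n^2$ states reachable from the initial state, i.e. at most $g(n)+O(n^2)$ distinct subsets of $Q$ arise from $Q_0$ by reading the strings $a^m$, $m\geqslant 0$. -/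

import Mathlib

/-- The values `lcm (p₁, …, p_k)` over all `k ≥ 1` and all positive integers `p₁, …, p_k`
with `p₁ + … + p_k ≤ n`. -/
def landauValues (n : ℕ) : Set ℕ :=
  {m | ∃ p : Multiset ℕ, p ≠ 0 ∧ (∀ x ∈ p, 1 ≤ x) ∧ p.sum ≤ n ∧ p.lcm = m}

/-- Landau's function: the largest element of `landauValues n` (for `n ≥ 1`). -/
noncomputable def landau (n : ℕ) : ℕ := sSup (landauValues n)

/-- For `n ≥ 1` the supremum in the definition of `landau` is an attained maximum. -/
theorem isGreatest_landau {n : ℕ} (hn : 1 ≤ n) : IsGreatest (landauValues n) (landau n) := by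
  have hne : (landauValues n).Nonempty :=
    ⟨1, {1}, by simp, by simp, by simpa using hn, by simp⟩
  have hbdd : BddAbove (landauValues n) := by
    refine ⟨n.factorial, ?_⟩
    rintro m ⟨p, -, hpos, hsum, rfl⟩
    refine Nat.le_of_dvd n.factorial_pos (Multiset.lcm_dvd.2 fun x hx => ?_)
    exact Nat.dvd_factorial (hpos x hx) ((Multiset.le_sum_of_mem hx).trans hsum)
  exact ⟨Nat.sSup_mem hne hbdd, fun m hm => le_csSup hbdd hm⟩

/-- The states of a DFA that are reached from its initial state by reading some string. -/
def DFA.reachableStates {α σ : Type*} (M : DFA α σ) : Set σ := Set.range M.eval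

open Finset

/-! Reading `a^m` yields the endpoints of the walks of length `m` from the initial states. A walk of
length at least `n` meets a vertex `v` on a closed walk, and `HasWalk.of_modEq_walkPeriod` changes
its length to any length at least `2 * n ^ 2` in the same class modulo all periods. Periods are
constant on strong components and at most their sizes, so their lcm `L` is at most `landau n`
(`exists_common_period_le_landau`). The subsets thus repeat with period `L` from index `2 * n ^ 2`
on, leaving at most `L + 2 * n ^ 2`. -/

section Walks

variable {V : Type*} (R : V → V → Prop)

/-- `HasWalk R m u v` says that the relation `R` has a walk of length `m` from `u` to `v`. -/
def HasWalk : ℕ → V → V → Prop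
  | 0, u, v => u = v
  | m + 1, u, v => ∃ w, HasWalk m u w ∧ R w v

variable {R}

theorem hasWalk_add {a b : ℕ} {u w : V} :
    HasWalk R (a + b) u w ↔ ∃ v, HasWalk R a u v ∧ HasWalk R b v w := by
  induction b generalizing w with
  | zero => simp [HasWalk]
  | succ b ih =>
    rw [← add_assoc]
    simp only [HasWalk, ih]
    constructor
    · rintro ⟨x, ⟨v, h1, h2⟩, h3⟩
      exact ⟨v, h1, x, h2, h3⟩
    · rintro ⟨v, h1, x, h2, h3⟩
      exact ⟨x, ⟨v, h1, h2⟩, h3⟩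

theorem HasWalk.append {a b : ℕ} {u v w : V} (h : HasWalk R a u v) (h' : HasWalk R b v w) :
    HasWalk R (a + b) u w :=
  hasWalk_add.2 ⟨v, h, h'⟩

theorem HasWalk.exists_vertices {m : ℕ} {u v : V} (h : HasWalk R m u v) :
    ∃ f : ℕ → V, f 0 = u ∧ f m = v ∧ ∀ i j, i + j ≤ m → HasWalk R j (f i) (f (i + j)) := by
  induction m generalizing v with
  | zero =>
    refine ⟨fun _ => u, rfl, h, fun i j hij => ?_⟩
    obtain rfl : j = 0 := by omega
    rfl
  | succ m ih =>
    obtain ⟨w, hw, hwv⟩ := h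
    obtain ⟨f, h0, hm, hf⟩ := ih hw
    refine ⟨fun i => if i ≤ m then f i else v, by simp [h0], by simp, fun i j hij => ?_⟩
    rcases Nat.lt_or_ge m (i + j) with hlt | hle
    · rcases Nat.eq_zero_or_pos j with rfl | hj
      · rfl
      · obtain ⟨k, rfl⟩ : ∃ k, j = k + 1 := ⟨j - 1, by omega⟩
        have hk : i + k = m := by omega
        have := hf i k hk.le
        rw [hk, hm] at this
        have hstep : HasWalk R (k + 1) (f i) v := ⟨w, this, hwv⟩
        simpa only [show i ≤ m by omega, show ¬ i + (k + 1) ≤ m by omega, if_true, if_false]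
          using hstep
    · simpa [show i ≤ m by omega, hle] using hf i j hle

variable (R) in
/-- The lengths of the closed walks at `v`. -/
def closedWalkLengths (v : V) : AddSubmonoid ℕ where
  carrier := {m | HasWalk R m v v}
  zero_mem' := rfl
  add_mem' h h' := h.append h'

theorem mem_closedWalkLengths {v : V} {m : ℕ} :
    m ∈ closedWalkLengths R v ↔ HasWalk R m v v := Iff.rfl

variable (R) in
/-- The period of a vertex: the greatest common divisor of the lengths of its closed walks, or
`1` if there is no closed walk of positive length. -/
noncomputable def walkPeriod (v : V) : ℕ :=
  max 1 (Nat.setGcd (closedWalkLengths R v : Set ℕ))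

variable (R) in
/-- Two vertices are equivalent if there are walks between them in both directions. -/
def mutuallyReachable : Setoid V where
  r u v := (∃ a, HasWalk R a u v) ∧ ∃ b, HasWalk R b v u
  iseqv :=
    { refl := fun _ => ⟨⟨0, rfl⟩, 0, rfl⟩
      symm := fun h => ⟨h.2, h.1⟩
      trans := by
        rintro u v w ⟨⟨a, ha⟩, b, hb⟩ ⟨⟨c, hc⟩, d, hd⟩
        exact ⟨⟨_, ha.append hc⟩, _, hd.append hb⟩ }

theorem setGcd_closedWalkLengths_dvd {u v : V} {a b : ℕ} (ha : HasWalk R a u v)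
    (hb : HasWalk R b v u) :
    Nat.setGcd (closedWalkLengths R u : Set ℕ) ∣ Nat.setGcd (closedWalkLengths R v : Set ℕ) := by
  refine Nat.dvd_setGcd_iff.2 fun x hx => ?_
  have h1 : a + b ∈ (closedWalkLengths R u : Set ℕ) := ha.append hb
  have h2 : a + b + x ∈ (closedWalkLengths R u : Set ℕ) := by
    rw [add_right_comm]
    exact (ha.append hx).append hb
  exact (Nat.dvd_add_right (Nat.setGcd_dvd_of_mem h1)).1 (Nat.setGcd_dvd_of_mem h2)

theorem walkPeriod_congr {u v : V} (h : mutuallyReachable R u v) :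
    walkPeriod R u = walkPeriod R v := by
  obtain ⟨⟨a, ha⟩, b, hb⟩ := h
  rw [walkPeriod, walkPeriod, Nat.dvd_antisymm (setGcd_closedWalkLengths_dvd ha hb)
    (setGcd_closedWalkLengths_dvd hb ha)]

theorem walkPeriod_dvd {v : V} {a : ℕ} (ha : 0 < a) (h : HasWalk R a v v) :
    walkPeriod R v = Nat.setGcd (closedWalkLengths R v : Set ℕ) ∧ walkPeriod R v ∣ a := by
  have hd : Nat.setGcd (closedWalkLengths R v : Set ℕ) ∣ a := Nat.setGcd_dvd_of_mem h
  have : walkPeriod R v = Nat.setGcd (closedWalkLengths R v : Set ℕ) :=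
    max_eq_right (Nat.pos_of_dvd_of_pos hd ha)
  exact ⟨this, this ▸ hd⟩

variable [Finite V]

/-- A shortest closed walk of positive length through `v` repeats no vertex before it closes, and it
stays in the class of `v`. -/
theorem exists_closedWalk_le_ncard {v : V} {a : ℕ} (ha : 0 < a) (h : HasWalk R a v v) :
    ∃ b, 0 < b ∧ b ≤ {u | mutuallyReachable R u v}.ncard ∧ HasWalk R b v v := by
  classical
  have hex : ∃ b, 0 < b ∧ HasWalk R b v v := ⟨a, ha, h⟩
  obtain ⟨hb, hw⟩ := Nat.find_spec hex
  set b := Nat.find hex with hbdef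
  refine ⟨b, hb, ?_, hw⟩
  obtain ⟨f, h0, hm, hf⟩ := hw.exists_vertices
  have hpre : ∀ i ≤ b, HasWalk R i v (f i) := fun i hi => by
    simpa [h0] using hf 0 i (by omega)
  have hsuf : ∀ i ≤ b, HasWalk R (b - i) (f i) v := fun i hi => by
    simpa [hm, show i + (b - i) = b by omega] using hf i (b - i) (by omega)
  have hne : ∀ i j, i < j → j < b → f i ≠ f j := fun i j hij hj he => by
    have h1 := (hpre i (by omega)).append (he ▸ hsuf j hj.le)
    exact Nat.find_min hex (show i + (b - j) < b by omega) ⟨by omega, h1⟩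
  have hinj : Set.InjOn f (Set.Iio b) := fun i hi j hj he => by
    rcases lt_trichotomy i j with hij | hij | hij
    · exact (hne i j hij hj he).elim
    · exact hij
    · exact (hne j i hij hi he.symm).elim
  calc b = (f '' Set.Iio b).ncard := by rw [hinj.ncard_image]; simp
    _ ≤ _ := Set.ncard_le_ncard (by
      rintro _ ⟨i, hi, rfl⟩
      have hi' : i ≤ b := le_of_lt hi
      exact ⟨⟨_, hsuf i hi'⟩, _, hpre i hi'⟩) (Set.toFinite _)

theorem walkPeriod_le_ncard (v : V) :
    walkPeriod R v ≤ {u | mutuallyReachable R u v}.ncard := by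
  have hpos : 1 ≤ {u | mutuallyReachable R u v}.ncard :=
    (Set.ncard_pos (Set.toFinite _)).2 ⟨v, (mutuallyReachable R).refl v⟩
  by_cases h : ∃ a, 0 < a ∧ HasWalk R a v v
  · obtain ⟨a, ha, hw⟩ := h
    obtain ⟨b, hb, hle, hw⟩ := exists_closedWalk_le_ncard ha hw
    exact (Nat.le_of_dvd hb (walkPeriod_dvd hb hw).2).trans hle
  · have : Nat.setGcd (closedWalkLengths R v : Set ℕ) = 0 :=
      Nat.setGcd_eq_zero_iff.2 fun a ha => by
        by_contra hne
        exact h ⟨a, Nat.pos_of_ne_zero hne, ha⟩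
    simpa [walkPeriod, this] using hpos

/-- A walk can be shortened to length less than `Nat.card V * a` without changing the residue of
its length modulo `a`. -/
theorem HasWalk.exists_short_modEq {m a : ℕ} {u v : V} (h : HasWalk R m u v) (ha : 0 < a) :
    ∃ k, k < Nat.card V * a ∧ k ≡ m [MOD a] ∧ HasWalk R k u v := by
  induction m using Nat.strong_induction_on with
  | _ m ih =>
    rcases Nat.lt_or_ge m (Nat.card V * a) with hlt | hge
    · exact ⟨m, hlt, rfl, h⟩
    obtain ⟨f, h0, hm, hf⟩ := h.exists_vertices
    have : Fintype V := Fintype.ofFinite V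
    -- Pigeonhole on pairs (vertex, position mod `a`): cutting between equal pairs removes a
    -- multiple of `a`.
    obtain ⟨i, j, hij, he⟩ := Fintype.exists_ne_map_eq_of_card_lt
      (fun i : Fin (m + 1) => (f i, (⟨i % a, Nat.mod_lt _ ha⟩ : Fin a)))
      (by rw [Nat.card_eq_fintype_card] at hge; simp; omega)
    wlog hlt : i < j generalizing i j
    · exact this j i hij.symm he.symm (lt_of_le_of_ne (not_lt.1 hlt) hij.symm)
    obtain ⟨hfe, hmod⟩ : f i = f j ∧ (i : ℕ) % a = j % a := by simpa using he
    have hlt' : (i : ℕ) < j := hlt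
    have hjm : (j : ℕ) ≤ m := by omega
    have h1 : HasWalk R i u (f i) := by simpa [h0] using hf 0 i (by omega)
    have h2 : HasWalk R (m - j) (f j) v := by
      simpa [hm, show (j : ℕ) + (m - j) = m by omega] using hf j (m - j) (by omega)
    obtain ⟨k, hk, hkm, hw⟩ := ih (i + (m - j)) (by omega) (h1.append (hfe ▸ h2))
    refine ⟨k, hk, hkm.trans ?_, hw⟩
    have : (i : ℕ) + (m - j) ≡ j + (m - j) [MOD a] := Nat.ModEq.add_right _ hmod
    rwa [Nat.add_sub_cancel' hjm] at this

theorem HasWalk.exists_closedWalk {m : ℕ} {u w : V} (h : HasWalk R m u w) (hm : Nat.card V ≤ m) :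
    ∃ v s t a, s + t = m ∧ 0 < a ∧ HasWalk R s u v ∧ HasWalk R t v w ∧ HasWalk R a v v := by
  obtain ⟨f, h0, hm', hf⟩ := h.exists_vertices
  have : Fintype V := Fintype.ofFinite V
  obtain ⟨i, j, hij, he⟩ := Fintype.exists_ne_map_eq_of_card_lt (fun i : Fin (m + 1) => f i)
    (by rw [Nat.card_eq_fintype_card] at hm; simp; omega)
  wlog hlt : i < j generalizing i j
  · exact this j i hij.symm he.symm (lt_of_le_of_ne (not_lt.1 hlt) hij.symm)
  have hlt' : (i : ℕ) < j := hlt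
  refine ⟨f i, i, m - i, j - i, by omega, by omega, ?_, ?_, ?_⟩
  · simpa [h0] using hf 0 i (by omega)
  · simpa [hm', show (i : ℕ) + (m - i) = m by omega] using hf i (m - i) (by omega)
  · have := hf i (j - i) (by omega)
    rwa [show (i : ℕ) + (j - i) = j by omega, ← he] at this

/-- Shorten both halves modulo `a`; the missing length is then a multiple of `a`, filled by
repeating the closed walk at `v`. -/
theorem HasWalk.of_modEq_closedWalk {s t a m : ℕ} {u v w : V} (hs : HasWalk R s u v)
    (ht : HasWalk R t v w) (ha : 0 < a) (hc : HasWalk R a v v) (hm : 2 * (Nat.card V * a) ≤ m)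
    (hmod : s + t ≡ m [MOD a]) : HasWalk R m u w := by
  obtain ⟨s', hs', hsm, hs⟩ := hs.exists_short_modEq ha
  obtain ⟨t', ht', htm, ht⟩ := ht.exists_short_modEq ha
  obtain ⟨k, hk⟩ := (Nat.modEq_iff_dvd' (by omega)).1 ((hsm.add htm).trans hmod)
  have hka : HasWalk R (k * a) v v := by
    simpa using mem_closedWalkLengths.1 ((closedWalkLengths R v).nsmul_mem hc k)
  have := (hs.append hka).append ht
  rwa [show s' + k * a + t' = m by rw [mul_comm k, ← hk]; omega] at this

/-- Long walks may be replaced by walks of any other large length that has the same residues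
modulo all periods. -/
theorem HasWalk.of_modEq_walkPeriod {m m' : ℕ} {u w : V} (h : HasWalk R m u w)
    (hm : Nat.card V ≤ m) (hm' : 2 * Nat.card V ^ 2 ≤ m')
    (hmod : ∀ v, m ≡ m' [MOD walkPeriod R v]) : HasWalk R m' u w := by
  obtain ⟨v, s, t, a, hst, ha, hs, ht, hc⟩ := h.exists_closedWalk hm
  obtain ⟨b, hb, hle, hcb⟩ := exists_closedWalk_le_ncard ha hc
  obtain ⟨hper, hdvd⟩ := walkPeriod_dvd hb hcb
  have hbV : b ≤ Nat.card V := hle.trans (Set.ncard_le_card _)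
  -- Every large multiple of the period is a closed walk length at `v`.
  obtain ⟨N, hN⟩ := Nat.exists_mem_closure_of_ge (closedWalkLengths R v : Set ℕ)
  rw [AddSubmonoid.closure_eq, ← hper] at hN
  have hlarge : m + N ≤ b * (m + N) := Nat.le_mul_of_pos_left _ hb
  have hbd : m' + b * (m + N) ≡ m' [MOD walkPeriod R v] := by
    simpa using (Nat.ModEq.refl m').add
      ((Nat.modEq_zero_iff_dvd).2 (hdvd.trans (Nat.dvd_mul_right b (m + N))))
  -- A detour of length `c` at `v` upgrades congruence modulo the period to congruence modulo `b`;
  -- the term `b * (m + N)` only makes `c ≥ N`.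
  obtain ⟨c, hc'⟩ : ∃ c, m + c = m' + b * (m + N) := ⟨m' + b * (m + N) - m, by omega⟩
  have hcmem : HasWalk R c v v := by
    refine hN c (by omega) ?_
    have := (Nat.modEq_iff_dvd' (by omega)).1 ((hmod v).trans hbd.symm)
    rwa [← hc', Nat.add_sub_cancel_left] at this
  refine (hs.append hcmem).of_modEq_closedWalk ht hb hcb ?_ ?_
  · exact le_trans (by rw [sq]; gcongr) hm'
  · rw [show s + c + t = m' + b * (m + N) by omega]
    simp [Nat.ModEq]

/-- The periods of all vertices have a common multiple bounded by Landau's function. -/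
theorem exists_common_period_le_landau [Nonempty V] (R : V → V → Prop) :
    ∃ L ≤ landau (Nat.card V), 0 < L ∧ ∀ v, walkPeriod R v ∣ L := by
  classical
  have : Fintype V := Fintype.ofFinite V
  let S := mutuallyReachable R
  let p : Multiset ℕ := (univ : Finset (Quotient S)).val.map fun c => walkPeriod R c.out
  have hp : ∀ x ∈ p, 1 ≤ x := by simp [p, walkPeriod]
  refine ⟨p.lcm, (isGreatest_landau Nat.card_pos).2 ⟨p, ?_, hp, ?_, rfl⟩, ?_, fun v => ?_⟩
  · obtain ⟨v⟩ := ‹Nonempty V›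
    have : Nonempty (Quotient S) := ⟨Quotient.mk S v⟩
    simp [p, univ_eq_empty_iff]
  · have hsum : p.sum = ∑ c : Quotient S, walkPeriod R c.out := rfl
    -- The classes partition `V`, so the periods can be bounded class by class.
    rw [hsum, Nat.card_eq_fintype_card, ← Finset.card_univ,
      Finset.card_eq_sum_card_fiberwise (f := Quotient.mk S) (t := univ) (by simp)]
    refine Finset.sum_le_sum fun c _ => (walkPeriod_le_ncard _).trans ?_
    rw [← Set.ncard_coe_finset]
    refine Set.ncard_le_ncard (fun u hu => ?_) (Set.toFinite _)
    have : Quotient.mk S u = c := (Quotient.sound hu).trans c.out_eq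
    simpa using this
  · exact Nat.pos_of_ne_zero fun h => absurd (hp 0 ((Multiset.lcm_eq_zero_iff _).1 h)) (by simp)
  · refine Multiset.dvd_lcm (Multiset.mem_map.2 ⟨Quotient.mk S v, by simp, ?_⟩)
    exact walkPeriod_congr (Quotient.mk_out (s := S) v)

end Walks

theorem NFA.mem_eval_iff_hasWalk {α Q : Type*} [Unique α] (A : NFA α Q) (x : List α) (q : Q) :
    q ∈ A.eval x ↔ ∃ u ∈ A.start, HasWalk (fun s t => t ∈ A.step s default) x.length u q := by
  induction x using List.reverseRecOn generalizing q with
  | nil => simp [HasWalk]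
  | append_singleton x a ih =>
    rw [NFA.eval_append_singleton, NFA.mem_stepSet, List.length_append, Subsingleton.elim a default]
    simp only [ih, List.length_singleton, HasWalk]
    constructor
    · rintro ⟨t, ⟨u, hu, hw⟩, hq⟩
      exact ⟨u, hu, t, hw, hq⟩
    · rintro ⟨u, hu, t, hw, hq⟩
      exact ⟨t, ⟨u, hu, hw⟩, hq⟩

theorem ncard_range_le_of_eventually_periodic {β : Type*} {f : ℕ → β} {K L : ℕ} (hL : 0 < L)
    (h : ∀ m, K ≤ m → f (m + L) = f m) : (Set.range f).ncard ≤ L + K := by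
  have hsub : Set.range f ⊆ f '' Set.Iio (L + K) := by
    rintro _ ⟨m, rfl⟩
    induction m using Nat.strong_induction_on with
    | _ m ih =>
      rcases Nat.lt_or_ge m (L + K) with hlt | hge
      · exact ⟨m, hlt, rfl⟩
      · have := h (m - L) (by omega)
        rw [Nat.sub_add_cancel (by omega)] at this
        rw [this]
        exact ih (m - L) (by omega)
  calc (Set.range f).ncard ≤ (f '' Set.Iio (L + K)).ncard :=
        Set.ncard_le_ncard hsub ((Set.finite_Iio _).image f)
    _ ≤ (Set.Iio (L + K)).ncard := Set.ncard_image_le (Set.finite_Iio _)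
    _ = L + K := by simp

/-- There is an absolute constant `C` such that, for every NFA `A` over a one-letter alphabet
with `n ≥ 1` states, at most `landau n + C * n ^ 2` states of the DFA obtained from `A` by the
subset construction are reachable. -/
theorem mainTheorem5 :
    ∃ C : ℕ, ∀ (α : Type*) (Q : Type*) [Unique α] [Finite Q] [Nonempty Q] (A : NFA α Q),
      A.toDFA.reachableStates.ncard ≤ landau (Nat.card Q) + C * Nat.card Q ^ 2 := by
  refine ⟨2, fun α Q _ _ _ A => ?_⟩
  let R : Q → Q → Prop := fun s t => t ∈ A.step s default
  obtain ⟨L, hL, hpos, hdvd⟩ := exists_common_period_le_landau R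
  let f : ℕ → Set Q := fun m => {q | ∃ u ∈ A.start, HasWalk R m u q}
  have hrange : A.toDFA.reachableStates ⊆ Set.range f := by
    rintro _ ⟨x, rfl⟩
    exact ⟨x.length, Set.ext fun q => (A.mem_eval_iff_hasWalk x q).symm⟩
  have hn : Nat.card Q ≤ 2 * Nat.card Q ^ 2 := by nlinarith [Nat.card_pos (α := Q)]
  have hmod (m : ℕ) (v : Q) : m + L ≡ m [MOD walkPeriod R v] := by
    simpa using (Nat.ModEq.refl m).add (Nat.modEq_zero_iff_dvd.2 (hdvd v))
  have hper : ∀ m, 2 * Nat.card Q ^ 2 ≤ m → f (m + L) = f m := fun m hm => by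
    ext q
    refine exists_congr fun u => and_congr_right fun _ => ⟨fun h => ?_, fun h => ?_⟩
    · exact h.of_modEq_walkPeriod (by omega) hm (hmod m)
    · exact h.of_modEq_walkPeriod (by omega) (by omega) fun v => (hmod m v).symm
  calc A.toDFA.reachableStates.ncard ≤ (Set.range f).ncard :=
        Set.ncard_le_ncard hrange (Set.toFinite _)
    _ ≤ L + 2 * Nat.card Q ^ 2 := ncard_range_le_of_eventually_periodic hpos hper
    _ ≤ _ := by gcongr
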